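/- Let $K$ be a field, $\overline K$ an algebraic closure of $K$, $\nu$ a valuation on $K[x]$ with values in $\Gamma\cup\{\infty\}$ ($\Gamma$ a linearly ordered abelian group, $\nu(f)=\infty$ only for $f=0$), and $\mu$ an extension of $\nu$ to $\overline K[x]$. For $f\in K[x]$ nonconstant put $\delta(f)=\max\{\mu(x-a)\mid a\in\overline K,\ f(a)=0\}$ and $\epsilon(f)=\max_{r\ge 1}\frac{\nu(f)-\nu(\partial_r f)}{r}$ (a maximum in $\Gamma\otimes\mathbb Q$ over the $r$ with $\partial_r f\neq 0$), where $\partial_r f$ are the Taylor coefficients, $f(x+y)=\sum_{r\ge 0}\partial_rf(x)\,y^r$; for constant $f$ put $\epsilon(f)=-\infty$. A monic $Q\in K[x]$ is a *key polynomial* for $\nu$ if every $f\in K[x]$ with $\epsilon(f)\ge\epsilon(Q)$ satisfies $\deg f\ge\deg Q$. For nonconstant $q\in K[x]$ the *$q$-truncation* of $\nu$ is $\nu_q(p)=\min_i\nu(p_iq^i)$, where $p=\sum_i p_iq^i$ with $p_i=0$ or $\deg p_i<\deg q$. Let $\mu(\overline K[x])$ be the subgroup of $\Gamma$ generated by the finite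 values of $\mu$. A pair $(a,\delta)\in\overline K\times\mu(\overline K[x])$ is a *minimal pair* for $\nu$ if $[K(b):K]\ge[K(a):K]$ for every $b\in\overline K$ with $\mu(b-a)\ge\delta$. It is a *minimal pair of definition* for $\nu$ if in addition $\mu(x-a)=\delta\ge\mu(x-b)$ for every $b\in\overline K$. **Theorem.** Let $Q\in K[x]$ be monic irreducible, and let $a\in\overline K$ be a root of $Q$ with $\mu(x-a)=\delta(Q)$. Then $Q$ is a key polynomial for $\nu$ if and only if $(a,\delta(Q))$ is a minimal pair for $\nu$. Moreover, if $Q$ is a key polynomial for $\nu$, then $(a,\delta(Q))$ is a minimal pair of definition for $\nu$ if and only if $\nu=\nu_Q$. Without assuming that $Q$ is a key polynomial: if $(a,\delta(Q))$ is a minimal pair of definition for $\nu$, then $\nu=\nu_Q$; and if $\nu=\nu_Q$, then $\mu(x-a)\ge\mu(x-b)$ for every $b\in\overline K$. -/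

import Mathlib

open Polynomial

namespace KeyPoly

noncomputable section

section Base

variable {K : Type*} [Field K]
variable {Γ : Type*} [AddCommGroup Γ] [LinearOrder Γ] [IsOrderedAddMonoid Γ]

/-- `ε(f) = max_{r ≥ 1} (ν(f) - ν(∂_r f)) / r`, where `∂_r` is the `r`-th Hasse derivative, i.e. the
`r`-th coefficient of the Taylor expansion. The quotients live in the divisible hull
of the group `Γ`. The indices `r` with `ν(∂_r f) = ∞` (in particular all `r > deg f`) contribute
`-∞`, so only the remaining ones are listed; `ε(f) = ⊥ = -∞` if `f` is constant.
When `ν(f) ≠ ∞`, the two `untopD 0` below read off genuine finite values. -/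
def epsilon (ν : AddValuation K[X] (WithTop Γ)) (f : K[X]) : WithBot (DivisibleHull Γ) :=
  (((Finset.range f.natDegree).filter fun s => ν (hasseDeriv (s + 1) f) ≠ ⊤).image fun s =>
    DivisibleHull.mk ((ν f).untopD 0 - (ν (hasseDeriv (s + 1) f)).untopD 0) s.succPNat).max

/-- `Q` is a key polynomial for `ν`. -/
def IsKeyPolynomial (ν : AddValuation K[X] (WithTop Γ)) (Q : K[X]) : Prop :=
  Q.Monic ∧ ∀ f : K[X], epsilon ν Q ≤ epsilon ν f → Q.natDegree ≤ f.natDegree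

/-- The `i`-th coefficient `p_i` of the `q`-expansion `p = p_0 + p_1 q + p_2 q ^ 2 + ⋯`,
obtained by repeated division with remainder by `q`. -/
def expansionCoeff (q p : K[X]) (i : ℕ) : K[X] := ((fun g : K[X] => g / q)^[i] p) % q

theorem degree_expansionCoeff_lt {q : K[X]} (hq : q ≠ 0) (p : K[X]) (i : ℕ) :
    (expansionCoeff q p i).degree < q.degree :=
  EuclideanDomain.mod_lt _ hq

theorem sum_expansionCoeff {q : K[X]} (hq : 0 < q.natDegree) (p : K[X]) :
    ∑ i ∈ Finset.range (p.natDegree + 1), expansionCoeff q p i * q ^ i = p := by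
  have key : ∀ n (p : K[X]), ∑ i ∈ Finset.range n, expansionCoeff q p i * q ^ i
      + ((fun g : K[X] => g / q)^[n] p) * q ^ n = p := by
    intro n p
    induction n with
    | zero => simp
    | succ n ih =>
      rw [Finset.sum_range_succ, Function.iterate_succ_apply']
      conv_rhs => rw [← ih]
      rw [add_assoc, expansionCoeff]
      congr 1
      conv_rhs => rw [← EuclideanDomain.mod_add_div ((fun g : K[X] => g / q)^[n] p) q]
      ring
  have van : ∀ n (p : K[X]), p.natDegree < n → (fun g : K[X] => g / q)^[n] p = 0 := by
    intro n
    induction n with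
    | zero => intro p h; omega
    | succ n ih =>
      intro p h
      rw [Function.iterate_succ_apply]
      by_cases h0 : n = 0
      · subst h0
        have hd : p.degree < q.degree := by
          apply Polynomial.degree_lt_degree
          omega
        simpa using (Polynomial.div_eq_zero_iff (by rintro rfl; simp at hq)).2 hd
      · apply ih
        by_cases hp : p = 0
        · subst hp
          simpa using Nat.pos_of_ne_zero h0
        · have hq0 : 0 < q.degree := Polynomial.natDegree_pos_iff_degree_pos.1 hq
          have hlt := Polynomial.degree_div_lt hp hq0
          have : (p / q).natDegree < n ∨ p / q = 0 := by
            by_cases hz : p / q = 0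
            · exact Or.inr hz
            · have := Polynomial.natDegree_lt_natDegree hz hlt
              left; omega
          rcases this with h1 | h1
          · exact h1
          · rw [h1]
            simpa using Nat.pos_of_ne_zero h0
  have := key (p.natDegree + 1) p
  rwa [van _ p (Nat.lt_succ_self _), zero_mul, add_zero] at this

/-- The `q`-truncation `ν_q(p) = min_i ν(p_i q ^ i)` (for nonconstant `q`), the minimum being over
the `q`-expansion of `p`, which has at most `deg p + 1` nonzero terms. -/
def truncation (ν : AddValuation K[X] (WithTop Γ)) (q p : K[X]) : WithTop Γ :=
  (Finset.range (p.natDegree + 1)).inf fun i => ν (expansionCoeff q p i * q ^ i)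

/-- The value group of a valuation on a ring: the subgroup of `Γ` generated by
the finite values. -/
def valueGroup {R : Type*} [CommRing R] (μ : AddValuation R (WithTop Γ)) : AddSubgroup Γ :=
  AddSubgroup.closure {γ | ∃ g : R, μ g = (γ : WithTop Γ)}

end Base

section Extension

variable (K : Type*) [Field K] {L : Type*} [Field L] [Algebra K L]
variable {Γ : Type*} [AddCommGroup Γ] [LinearOrder Γ] [IsOrderedAddMonoid Γ]

/-- `(a, δ)` is a minimal pair; here `L` is the algebraic closure of `K`
and `μ` is the chosen extension to `L[x]` of the valuation on `K[x]`. -/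
def IsMinimalPair (μ : AddValuation L[X] (WithTop Γ)) (a : L) (δ : Γ) : Prop :=
  δ ∈ valueGroup μ ∧
    ∀ b : L, (δ : WithTop Γ) ≤ μ (C (b - a)) →
      Module.finrank K (IntermediateField.adjoin K {a}) ≤
        Module.finrank K (IntermediateField.adjoin K {b})

/-- `(a, δ)` is a minimal pair of definition. -/
def IsMinimalPairOfDefinition (μ : AddValuation L[X] (WithTop Γ)) (a : L) (δ : Γ) : Prop :=
  IsMinimalPair K μ a δ ∧ μ (X - C a) = (δ : WithTop Γ) ∧
    ∀ b : L, μ (X - C b) ≤ (δ : WithTop Γ)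

variable {K}

open Classical in
/-- `δ(f) = max {μ(x - a) | a a root of f in L}` (it is `⊥` if there are no roots). -/
def delta (μ : AddValuation L[X] (WithTop Γ)) (f : K[X]) : WithBot (WithTop Γ) :=
  ((f.aroots L).toFinset.image fun a => μ (X - C a)).max

end Extension

end

end KeyPoly

/-! Everything is read off the Taylor expansion at the generic point,
`f(b) = ∑ ∂_r f · (b - x) ^ r` in `L[x]`. If `b` is a root of `f`, then some term with `r ≥ 1` has
value at most `μ(f)`; conversely, if `μ(x - c) ≤ γ` for all roots `c` of `f`, then
`μ(f) ≤ μ(∂_r f) + r γ`, because this property is multiplicative in `f`, and the inequality is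
strict for `r ≥ 1` when `μ(x - c) < γ`. Hence `ε(f) = δ(f)`, which turns the degree condition on key
polynomials into the one on minimal pairs. It also follows that `μ(f(b) - f) > μ(f)` as soon as
`b` is strictly closer to `x` than every root of `f`.

The equality `ν = ν_q` amounts to `ν(p) ≤ ν(p % q)` for all `p`. For a minimal pair of definition
this is `ν(p) ≤ μ(p(a)) = μ((p % Q)(a)) = ν(p % Q)`. If instead `ν = ν_q` and some `b` is closer to
`x` than all the roots of `q`, take such a `b` of minimal degree and a nonzero multiple `p` of its
minimal polynomial such that `p / q` and `p % q` have smaller degree than `b`. Then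
`q * (p / q)` and `p % q` have values at least `ν(p)` and differ from their values at `b` by
something of value greater than `ν(p)`; so does `p`, which contradicts `p(b) = 0`.
-/

namespace KeyPoly

section Taylor

variable {R : Type*} [CommRing R]

theorem map_hasseDeriv {S : Type*} [CommRing S] (φ : R →+* S) (r : ℕ) (f : R[X]) :
    (hasseDeriv r f).map φ = hasseDeriv r (f.map φ) := by
  ext n
  simp only [coeff_map, hasseDeriv_coeff, map_mul, map_natCast]

theorem C_eval_eq_sum_hasseDeriv (f : R[X]) (b : R) :
    C (f.eval b) = ∑ r ∈ Finset.range (f.natDegree + 1), hasseDeriv r f * (C b - X) ^ r := by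
  have hcoeff (r : ℕ) : (taylor X (f.map C)).coeff r = hasseDeriv r f := by
    rw [taylor_coeff, ← map_hasseDeriv, eval_map, eval₂_C_X]
  have hdeg : (taylor X (f.map C)).natDegree < f.natDegree + 1 := by
    rw [natDegree_taylor]
    exact Nat.lt_succ_of_le natDegree_map_le
  calc C (f.eval b) = (taylor X (f.map C)).eval (C b - X) := by
        rw [taylor_eval_sub, eval_map, eval₂_at_apply]
    _ = _ := by simp only [eval_eq_sum_range' hdeg, hcoeff]

theorem C_eval_sub_eq_sum_hasseDeriv (f : R[X]) (b : R) :
    C (f.eval b) - f =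
      ∑ r ∈ Finset.range f.natDegree, hasseDeriv (r + 1) f * (C b - X) ^ (r + 1) := by
  rw [C_eval_eq_sum_hasseDeriv, Finset.sum_range_succ', hasseDeriv_zero', pow_zero, mul_one,
    add_sub_cancel_right]

variable {Γ₀ : Type*} [LinearOrderedAddCommMonoidWithTop Γ₀] {μ : AddValuation R[X] Γ₀}

theorem val_mul_C_sub_X_pow (f : R[X]) (b : R) (r : ℕ) :
    μ (f * (C b - X) ^ r) = μ f + r • μ (X - C b) := by
  rw [μ.map_mul, μ.map_pow, μ.map_sub_swap]

theorem exists_val_hasseDeriv_add_le_of_isRoot {f : R[X]} (hf : μ f ≠ ⊤) {b : R}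
    (hb : f.IsRoot b) : ∃ r, μ (hasseDeriv (r + 1) f) + (r + 1) • μ (X - C b) ≤ μ f := by
  by_contra! h
  refine lt_irrefl (μ f) ?_
  calc μ f < μ (C (f.eval b) - f) := by
        rw [C_eval_sub_eq_sum_hasseDeriv]
        exact μ.map_lt_sum hf fun r _ => (h r).trans_eq (val_mul_C_sub_X_pow _ _ _).symm
    _ = μ f := by rw [hb.eq_zero, C_0, zero_sub, μ.map_neg]

theorem val_mul_le_val_hasseDeriv_mul {γ : Γ₀} {f g : R[X]}
    (hf : ∀ r, μ f ≤ μ (hasseDeriv r f) + r • γ) (hg : ∀ r, μ g ≤ μ (hasseDeriv r g) + r • γ)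
    (r : ℕ) : μ (f * g) ≤ μ (hasseDeriv r (f * g)) + r • γ := by
  obtain ⟨ij, hij, hmin⟩ := Finset.exists_min_image (Finset.HasAntidiagonal.antidiagonal r)
    (fun ij => μ (hasseDeriv ij.1 f * hasseDeriv ij.2 g)) ⟨(0, r), by simp⟩
  calc μ (f * g) = μ f + μ g := μ.map_mul f g
    _ ≤ (μ (hasseDeriv ij.1 f) + ij.1 • γ) + (μ (hasseDeriv ij.2 g) + ij.2 • γ) :=
        add_le_add (hf _) (hg _)
    _ = μ (hasseDeriv ij.1 f * hasseDeriv ij.2 g) + r • γ := by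
        rw [μ.map_mul, ← Finset.HasAntidiagonal.mem_antidiagonal.1 hij, add_nsmul, add_add_add_comm]
    _ ≤ μ (hasseDeriv r (f * g)) + r • γ := by
        rw [hasseDeriv_mul]
        gcongr
        exact μ.map_le_sum hmin

theorem val_C_le_val_hasseDeriv_C (c : R) (γ : Γ₀) (r : ℕ) :
    μ (C c) ≤ μ (hasseDeriv r (C c)) + r • γ := by
  rcases r with _ | r
  · simp
  · simp [hasseDeriv_C]

theorem val_X_sub_C_le_val_hasseDeriv_X_sub_C {c : R} {γ : Γ₀} (hc : μ (X - C c) ≤ γ) (r : ℕ) :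
    μ (X - C c) ≤ μ (hasseDeriv r (X - C c)) + r • γ := by
  rcases r with _ | _ | r
  · simp
  · simpa using hc
  · simp [hasseDeriv_C, hasseDeriv_X]

variable [IsDomain R]

theorem val_le_val_hasseDeriv_of_splits {f : R[X]} (hf : f.Splits) {γ : Γ₀}
    (hγ : ∀ c ∈ f.roots, μ (X - C c) ≤ γ) (r : ℕ) : μ f ≤ μ (hasseDeriv r f) + r • γ := by
  rw [hf.eq_prod_roots]
  refine val_mul_le_val_hasseDeriv_mul (val_C_le_val_hasseDeriv_C _ _) ?_ r
  refine Multiset.prod_induction (fun g : R[X] => ∀ r, μ g ≤ μ (hasseDeriv r g) + r • γ) _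
    (fun _ _ => val_mul_le_val_hasseDeriv_mul) (val_C_le_val_hasseDeriv_C 1 γ) fun g hg => ?_
  obtain ⟨c, hc, rfl⟩ := Multiset.mem_map.1 hg
  exact val_X_sub_C_le_val_hasseDeriv_X_sub_C (hγ c hc)

theorem val_le_val_C_eval_of_splits {f : R[X]} (hf : f.Splits) {b : R}
    (hb : ∀ c ∈ f.roots, μ (X - C c) ≤ μ (X - C b)) : μ f ≤ μ (C (f.eval b)) := by
  rw [C_eval_eq_sum_hasseDeriv]
  exact μ.map_le_sum fun r _ =>
    (val_le_val_hasseDeriv_of_splits hf hb r).trans_eq (val_mul_C_sub_X_pow _ _ _).symm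

end Taylor

section StrictTaylor

variable {R : Type*} [CommRing R] [IsDomain R]
variable {Γ : Type*} [AddCommGroup Γ] [LinearOrder Γ] [IsOrderedAddMonoid Γ]
variable {μ : AddValuation R[X] (WithTop Γ)}

theorem withTop_succ_nsmul_lt_succ_nsmul {a b : WithTop Γ} (h : a < b) (n : ℕ) :
    (n + 1) • a < (n + 1) • b := by
  have hna : n • a ≠ ⊤ := by
    lift a to Γ using ne_top_of_lt h
    exact WithTop.coe_ne_top
  rw [succ_nsmul, succ_nsmul]
  exact WithTop.add_lt_add_of_le_of_lt hna (nsmul_le_nsmul_right h.le n) h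

theorem lt_val_hasseDeriv_of_splits {f : R[X]} (hf : f.Splits) {γ m : WithTop Γ}
    (hγ : ∀ c ∈ f.roots, μ (X - C c) < γ) (hm : m ≠ ⊤) (hmf : m ≤ μ f) (r : ℕ) :
    m < μ (hasseDeriv (r + 1) f) + (r + 1) • γ := by
  classical
  by_cases hderiv : μ (hasseDeriv (r + 1) f) = ⊤
  · rwa [hderiv, top_add, lt_top_iff_ne_top]
  have hdeg : f.natDegree ≠ 0 := by
    intro hdeg
    rw [hasseDeriv_eq_zero_of_lt_natDegree _ _ (by omega), μ.map_zero] at hderiv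
    exact hderiv rfl
  obtain ⟨b, hb, hmax⟩ := Finset.exists_max_image f.roots.toFinset (fun c => μ (X - C c))
    (by simpa using hf.roots_ne_zero hdeg)
  simp only [Multiset.mem_toFinset] at hb hmax
  calc m ≤ μ (hasseDeriv (r + 1) f) + (r + 1) • μ (X - C b) :=
        hmf.trans (val_le_val_hasseDeriv_of_splits hf hmax _)
    _ < μ (hasseDeriv (r + 1) f) + (r + 1) • γ :=
        WithTop.add_lt_add_left hderiv (withTop_succ_nsmul_lt_succ_nsmul (hγ b hb) r)

theorem lt_val_C_eval_sub_of_splits {f : R[X]} (hf : f.Splits) {b : R}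
    (hb : ∀ c ∈ f.roots, μ (X - C c) < μ (X - C b)) {m : WithTop Γ} (hm : m ≠ ⊤) (hmf : m ≤ μ f) :
    m < μ (C (f.eval b) - f) := by
  rw [C_eval_sub_eq_sum_hasseDeriv]
  exact μ.map_lt_sum hm fun r _ =>
    (lt_val_hasseDeriv_of_splits hf hb hm hmf r).trans_eq (val_mul_C_sub_X_pow _ _ _).symm

end StrictTaylor

section Epsilon

variable {K : Type*} [Field K]
variable {Γ : Type*} [AddCommGroup Γ] [LinearOrder Γ] [IsOrderedAddMonoid Γ]
variable {ν : AddValuation K[X] (WithTop Γ)} {f : K[X]} {γ : Γ}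

theorem coe_le_divisibleHull_mk_sub_iff {u w : WithTop Γ} (hu : u ≠ ⊤) (hw : w ≠ ⊤) {s : ℕ} :
    (γ : DivisibleHull Γ) ≤ DivisibleHull.mk (u.untopD 0 - w.untopD 0) s.succPNat ↔
      w + (s + 1) • (γ : WithTop Γ) ≤ u := by
  lift u to Γ using hu
  lift w to Γ using hw
  rw [DivisibleHull.mk_le_mk]
  norm_cast
  simp [le_sub_iff_add_le']

theorem divisibleHull_mk_sub_le_coe_iff {u w : WithTop Γ} (hu : u ≠ ⊤) (hw : w ≠ ⊤) {s : ℕ} :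
    DivisibleHull.mk (u.untopD 0 - w.untopD 0) s.succPNat ≤ (γ : DivisibleHull Γ) ↔
      u ≤ w + (s + 1) • (γ : WithTop Γ) := by
  lift u to Γ using hu
  lift w to Γ using hw
  rw [DivisibleHull.mk_le_mk]
  norm_cast
  simp [add_comm w]

theorem coe_le_epsilon_iff (hf : ν f ≠ ⊤) :
    ((γ : DivisibleHull Γ) : WithBot (DivisibleHull Γ)) ≤ epsilon ν f ↔
      ∃ r, ν (hasseDeriv (r + 1) f) + (r + 1) • (γ : WithTop Γ) ≤ ν f := by
  rw [epsilon, Finset.max_eq_sup_coe, Finset.le_sup_iff (WithBot.bot_lt_coe _)]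
  simp only [Finset.mem_image, Finset.mem_filter, Finset.mem_range, exists_exists_and_eq_and,
    WithBot.coe_le_coe]
  constructor
  · rintro ⟨r, ⟨-, hr⟩, hle⟩
    exact ⟨r, (coe_le_divisibleHull_mk_sub_iff hf hr).1 hle⟩
  · rintro ⟨r, hle⟩
    have hr : ν (hasseDeriv (r + 1) f) ≠ ⊤ :=
      (WithTop.add_ne_top.1 (ne_top_of_le_ne_top hf hle)).1
    have hdeg : r < f.natDegree := by
      by_contra! hdeg
      exact hr (by rw [hasseDeriv_eq_zero_of_lt_natDegree _ _ (by omega), ν.map_zero])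
    exact ⟨r, ⟨hdeg, hr⟩, (coe_le_divisibleHull_mk_sub_iff hf hr).2 hle⟩

theorem epsilon_le_coe (hf : ν f ≠ ⊤)
    (h : ∀ r, ν f ≤ ν (hasseDeriv (r + 1) f) + (r + 1) • (γ : WithTop Γ)) :
    epsilon ν f ≤ ((γ : DivisibleHull Γ) : WithBot (DivisibleHull Γ)) := by
  refine Finset.max_le fun x hx => ?_
  obtain ⟨r, hr, rfl⟩ := Finset.mem_image.1 hx
  exact WithBot.coe_le_coe.2
    ((divisibleHull_mk_sub_le_coe_iff hf (Finset.mem_filter.1 hr).2).2 (h r))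

end Epsilon

section Truncation

variable {K : Type*} [Field K]
variable {Γ : Type*} [AddCommGroup Γ] [LinearOrder Γ] [IsOrderedAddMonoid Γ]

theorem expansionCoeff_zero (q p : K[X]) : expansionCoeff q p 0 = p % q := rfl

theorem expansionCoeff_succ (q p : K[X]) (i : ℕ) :
    expansionCoeff q p (i + 1) = expansionCoeff q (p / q) i := by
  rw [expansionCoeff, Function.iterate_succ_apply, expansionCoeff]

theorem val_le_val_mul_div {ν : AddValuation K[X] (WithTop Γ)} {q p : K[X]}
    (h : ν p ≤ ν (p % q)) : ν p ≤ ν (q * (p / q)) := by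
  rw [eq_sub_of_add_eq (EuclideanDomain.div_add_mod p q)]
  exact ν.map_le_sub le_rfl h

theorem val_le_val_expansionCoeff_mul_pow {ν : AddValuation K[X] (WithTop Γ)} {q : K[X]}
    (h : ∀ p, ν p ≤ ν (p % q)) (p : K[X]) (i : ℕ) : ν p ≤ ν (expansionCoeff q p i * q ^ i) := by
  induction i generalizing p with
  | zero => simpa only [expansionCoeff_zero, pow_zero, mul_one] using h p
  | succ i ih =>
    calc ν p ≤ ν (q * (p / q)) := val_le_val_mul_div (h p)
      _ = ν q + ν (p / q) := ν.map_mul _ _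
      _ ≤ ν q + ν (expansionCoeff q (p / q) i * q ^ i) := by gcongr; exact ih _
      _ = ν (expansionCoeff q p (i + 1) * q ^ (i + 1)) := by
        rw [expansionCoeff_succ, ← ν.map_mul, pow_succ', mul_left_comm]

theorem eq_truncation_iff {ν : AddValuation K[X] (WithTop Γ)} {q : K[X]} (hq : 0 < q.natDegree) :
    (∀ p, ν p = truncation ν q p) ↔ ∀ p, ν p ≤ ν (p % q) := by
  refine ⟨fun h p => ?_, fun h p => le_antisymm ?_ ?_⟩
  · calc ν p = truncation ν q p := h p
      _ ≤ ν (expansionCoeff q p 0 * q ^ 0) := Finset.inf_le (by simp)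
      _ = ν (p % q) := by rw [expansionCoeff_zero, pow_zero, mul_one]
  · exact Finset.le_inf fun i _ => val_le_val_expansionCoeff_mul_pow h p i
  · conv_rhs => rw [← sum_expansionCoeff hq p]
    exact ν.map_le_sum fun i hi => Finset.inf_le hi

theorem exists_dvd_natDegree_div_mod_lt {f q : K[X]} (hf : f.natDegree ≠ 0) (hq : q.Monic)
    (hq0 : q.natDegree ≠ 0) :
    ∃ p ≠ 0, f ∣ p ∧ (p / q).natDegree < f.natDegree ∧ (p % q).natDegree < f.natDegree := by
  have hdiv (p : K[X]) : (p / q).natDegree = p.natDegree - q.natDegree := by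
    rw [← divByMonic_eq_div _ hq, natDegree_divByMonic _ hq]
  rcases le_or_gt q.natDegree f.natDegree with hle | hlt
  · refine ⟨f, ?_, dvd_rfl, ?_, (natDegree_mod_lt f hq0).trans_le hle⟩
    · rintro rfl
      exact hf natDegree_zero
    · rw [hdiv]
      omega
  · have hmod : (q % f).natDegree < f.natDegree := natDegree_mod_lt q hf
    have hdeg : (q - q % f).natDegree = q.natDegree :=
      natDegree_sub_eq_left_of_natDegree_lt (hmod.trans hlt)
    refine ⟨q - q % f, ?_, Dvd.intro _ (eq_sub_of_add_eq (EuclideanDomain.div_add_mod q f)), ?_, ?_⟩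
    · exact ne_zero_of_natDegree_gt (hdeg ▸ Nat.pos_of_ne_zero hq0)
    · rw [hdiv, hdeg]
      omega
    · rw [sub_mod, EuclideanDomain.mod_self, zero_sub, natDegree_neg,
        (mod_eq_self_iff hq.ne_zero).2 (degree_lt_degree (hmod.trans hlt))]
      exact hmod

end Truncation

section Extension

variable {K : Type*} [Field K] {L : Type*} [Field L] [Algebra K L]
variable {Γ : Type*} [AddCommGroup Γ] [LinearOrder Γ] [IsOrderedAddMonoid Γ]
variable {ν : AddValuation K[X] (WithTop Γ)} {μ : AddValuation L[X] (WithTop Γ)}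

theorem val_X_sub_C_le_of_mem_aroots {f : K[X]} {δ : Γ}
    (hδ : delta μ f = ((δ : WithTop Γ) : WithBot (WithTop Γ))) {c : L} (hc : c ∈ f.aroots L) :
    μ (X - C c) ≤ δ := by
  classical
  rw [← WithBot.coe_le_coe, ← hδ]
  exact Finset.le_max (Finset.mem_image_of_mem (fun c => μ (X - C c)) (Multiset.mem_toFinset.2 hc))

section Algebraic

variable [Algebra.IsAlgebraic K L]

theorem natDegree_minpoly_le_of_mem_aroots {p : K[X]} {c : L} (hc : c ∈ p.aroots L) :
    (minpoly K c).natDegree ≤ p.natDegree :=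
  natDegree_le_of_dvd (minpoly.dvd K c (mem_aroots.1 hc).2) (mem_aroots.1 hc).1

theorem mem_aroots_minpoly (c : L) : c ∈ (minpoly K c).aroots L :=
  mem_aroots.2 ⟨minpoly.ne_zero (Algebra.IsIntegral.isIntegral c), minpoly.aeval K c⟩

theorem val_X_sub_C_ne_top (hν : ∀ f : K[X], ν f = ⊤ → f = 0)
    (hμ : ∀ f : K[X], μ (f.map (algebraMap K L)) = ν f) (c : L) : μ (X - C c) ≠ ⊤ := by
  obtain ⟨g, hg⟩ := dvd_iff_isRoot.2 (isRoot_of_mem_roots (mem_aroots_minpoly (K := K) c))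
  have hνc : ν (minpoly K c) ≠ ⊤ :=
    fun h => minpoly.ne_zero (Algebra.IsIntegral.isIntegral c) (hν _ h)
  rw [← hμ, hg, μ.map_mul, WithTop.add_ne_top] at hνc
  exact hνc.1

theorem isMinimalPair_iff {a : L} {δ : Γ} (ha : μ (X - C a) = δ) :
    IsMinimalPair K μ a δ ↔
      ∀ c : L, δ ≤ μ (X - C c) → (minpoly K a).natDegree ≤ (minpoly K c).natDegree := by
  have hball (c : L) : δ ≤ μ (C (c - a)) ↔ δ ≤ μ (X - C c) := by
    have hca : C (c - a) = (X - C a) - (X - C c) := by rw [C_sub]; ring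
    constructor <;> intro h
    · rw [← sub_sub_cancel (X - C a) (X - C c), ← hca]
      exact μ.map_le_sub ha.ge h
    · rw [hca]
      exact μ.map_le_sub ha.ge h
  have hfinrank (c : L) : Module.finrank K (IntermediateField.adjoin K {c}) =
      (minpoly K c).natDegree :=
    IntermediateField.adjoin.finrank (Algebra.IsIntegral.isIntegral c)
  have hδ : δ ∈ valueGroup μ := AddSubgroup.subset_closure ⟨_, ha⟩
  simp only [IsMinimalPair, hδ, true_and, hball, hfinrank]

theorem IsMinimalPair.val_X_sub_C_lt {a : L} {δ : Γ} (h : IsMinimalPair K μ a δ)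
    (ha : μ (X - C a) = δ) {p : K[X]} (hp : p.natDegree < (minpoly K a).natDegree) {c : L}
    (hc : c ∈ p.aroots L) : μ (X - C c) < μ (X - C a) := by
  by_contra! hle
  have hac := (isMinimalPair_iff ha).1 h c (ha ▸ hle)
  exact (hac.trans (natDegree_minpoly_le_of_mem_aroots hc)).not_gt hp

theorem exists_isMinimalPair_of_lt (hν : ∀ f : K[X], ν f = ⊤ → f = 0)
    (hμ : ∀ f : K[X], μ (f.map (algebraMap K L)) = ν f) {γ : WithTop Γ} {b : L}
    (hb : γ < μ (X - C b)) :
    ∃ (c : L) (δ : Γ), μ (X - C c) = δ ∧ γ < δ ∧ IsMinimalPair K μ c δ := by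
  obtain ⟨c, hc, hmin⟩ := exists_minimalFor_of_wellFoundedLT (fun c : L => γ < μ (X - C c))
    (fun c => (minpoly K c).natDegree) ⟨b, hb⟩
  obtain ⟨δ, hδ⟩ := WithTop.ne_top_iff_exists.1 (val_X_sub_C_ne_top hν hμ c)
  refine ⟨c, δ, hδ.symm, hδ ▸ hc, (isMinimalPair_iff hδ.symm).2 fun d hd => ?_⟩
  exact (le_total _ _).elim id (hmin (hc.trans_le (hδ ▸ hd)))

end Algebraic

variable [IsAlgClosed L]

theorem lt_val_C_aeval_sub (hμ : ∀ f : K[X], μ (f.map (algebraMap K L)) = ν f) {p : K[X]} {b : L}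
    (hb : ∀ c ∈ p.aroots L, μ (X - C c) < μ (X - C b)) {m : WithTop Γ} (hm : m ≠ ⊤)
    (hmp : m ≤ ν p) : m < μ (C (aeval b p) - p.map (algebraMap K L)) := by
  rw [← eval_map_algebraMap]
  exact lt_val_C_eval_sub_of_splits (IsAlgClosed.splits _) hb hm (hmp.trans_eq (hμ p).symm)

theorem coe_le_epsilon_iff_exists_mem_aroots (hν : ∀ f : K[X], ν f = ⊤ → f = 0)
    (hμ : ∀ f : K[X], μ (f.map (algebraMap K L)) = ν f) {f : K[X]} {γ : Γ} :
    ((γ : DivisibleHull Γ) : WithBot (DivisibleHull Γ)) ≤ epsilon ν f ↔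
      ∃ c ∈ f.aroots L, γ ≤ μ (X - C c) := by
  rcases eq_or_ne f 0 with rfl | hf0
  · simp [epsilon]
  have hf : μ (f.map (algebraMap K L)) ≠ ⊤ := fun h => hf0 (hν f (hμ f ▸ h))
  rw [coe_le_epsilon_iff (hμ f ▸ hf)]
  simp only [← hμ, map_hasseDeriv]
  constructor
  · rintro ⟨r, hr⟩
    by_contra! hlt
    exact (lt_val_hasseDeriv_of_splits (IsAlgClosed.splits _) hlt hf le_rfl r).not_ge hr
  · rintro ⟨c, hc, hγ⟩
    obtain ⟨r, hr⟩ := exists_val_hasseDeriv_add_le_of_isRoot hf (isRoot_of_mem_roots hc)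
    exact ⟨r, le_trans (by gcongr) hr⟩

theorem epsilon_eq_delta (hν : ∀ f : K[X], ν f = ⊤ → f = 0)
    (hμ : ∀ f : K[X], μ (f.map (algebraMap K L)) = ν f) {f : K[X]} {a : L} (haf : a ∈ f.aroots L)
    {δ : Γ} (ha : μ (X - C a) = δ)
    (hδ : delta μ f = ((δ : WithTop Γ) : WithBot (WithTop Γ))) :
    epsilon ν f = (δ : DivisibleHull Γ) := by
  refine le_antisymm (epsilon_le_coe (fun h => (mem_aroots.1 haf).1 (hν f h)) fun r => ?_)
    ((coe_le_epsilon_iff_exists_mem_aroots hν hμ).2 ⟨a, haf, ha.ge⟩)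
  rw [← hμ, ← hμ, map_hasseDeriv]
  exact val_le_val_hasseDeriv_of_splits (IsAlgClosed.splits _)
    (fun c hc => val_X_sub_C_le_of_mem_aroots hδ hc) _

variable [Algebra.IsAlgebraic K L]

theorem isKeyPolynomial_minpoly_iff_isMinimalPair (hν : ∀ f : K[X], ν f = ⊤ → f = 0)
    (hμ : ∀ f : K[X], μ (f.map (algebraMap K L)) = ν f) {a : L} {δ : Γ} (ha : μ (X - C a) = δ)
    (hδ : delta μ (minpoly K a) = ((δ : WithTop Γ) : WithBot (WithTop Γ))) :
    IsKeyPolynomial ν (minpoly K a) ↔ IsMinimalPair K μ a δ := by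
  rw [isMinimalPair_iff ha, IsKeyPolynomial, epsilon_eq_delta hν hμ (mem_aroots_minpoly a) ha hδ]
  simp only [coe_le_epsilon_iff_exists_mem_aroots hν hμ (L := L)]
  constructor
  · rintro ⟨-, hkey⟩ c hc
    exact hkey _ ⟨c, mem_aroots_minpoly c, hc⟩
  · rintro hmin
    refine ⟨minpoly.monic (Algebra.IsIntegral.isIntegral a), ?_⟩
    rintro f ⟨c, hcf, hc⟩
    exact (hmin c hc).trans (natDegree_minpoly_le_of_mem_aroots hcf)

theorem IsMinimalPairOfDefinition.eq_truncation
    (hμ : ∀ f : K[X], μ (f.map (algebraMap K L)) = ν f) {a : L} {δ : Γ}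
    (h : IsMinimalPairOfDefinition K μ a δ) (p : K[X]) : ν p = truncation ν (minpoly K a) p := by
  obtain ⟨hmin, ha, hmax⟩ := h
  have hdeg : 0 < (minpoly K a).natDegree := minpoly.natDegree_pos (Algebra.IsIntegral.isIntegral a)
  refine (eq_truncation_iff hdeg).2 (fun p => ?_) p
  rcases eq_or_ne (ν (p % minpoly K a)) ⊤ with htop | htop
  · exact htop ▸ le_top
  have hmod : μ (C (aeval a (p % minpoly K a))) = ν (p % minpoly K a) := by
    rw [← hμ] at htop ⊢
    exact μ.map_eq_of_lt_sub (lt_val_C_aeval_sub hμ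
      (fun c hc => hmin.val_X_sub_C_lt ha (natDegree_mod_lt p hdeg.ne') hc) htop (hμ _).le)
  calc ν p = μ (p.map (algebraMap K L)) := (hμ p).symm
    _ ≤ μ (C (aeval a p)) := by
      rw [← eval_map_algebraMap]
      exact val_le_val_C_eval_of_splits (IsAlgClosed.splits _) fun c _ => ha ▸ hmax c
    _ = μ (C (aeval a (p % minpoly K a))) := by
      conv_lhs => rw [← EuclideanDomain.div_add_mod p (minpoly K a)]
      rw [map_add, map_mul, minpoly.aeval, zero_mul, zero_add]
    _ = ν (p % minpoly K a) := hmod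

theorem val_X_sub_C_le_of_eq_truncation (hν : ∀ f : K[X], ν f = ⊤ → f = 0)
    (hμ : ∀ f : K[X], μ (f.map (algebraMap K L)) = ν f) {q : K[X]} (hq : q.Monic)
    (hq0 : 0 < q.natDegree) {γ : WithTop Γ} (hγ : ∀ c ∈ q.aroots L, μ (X - C c) ≤ γ)
    (h : ∀ p, ν p = truncation ν q p) (c : L) : μ (X - C c) ≤ γ := by
  by_contra! hc
  obtain ⟨b, δ, hbδ, hlt, hmin⟩ := exists_isMinimalPair_of_lt hν hμ hc
  obtain ⟨p, hp0, ⟨g, hg⟩, hdiv, hmod⟩ := exists_dvd_natDegree_div_mod_lt (f := minpoly K b)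
    (minpoly.natDegree_pos (Algebra.IsIntegral.isIntegral b)).ne' hq hq0.ne'
  have hp : ν p ≠ ⊤ := fun hp => hp0 (hν p hp)
  have hle : ν p ≤ ν (p % q) := (eq_truncation_iff hq0).1 h p
  have hmul_roots : ∀ c ∈ (q * (p / q)).aroots L, μ (X - C c) < μ (X - C b) := by
    intro c hc
    obtain ⟨hne, hroot⟩ := mem_aroots.1 hc
    rcases mul_eq_zero.1 ((map_mul (aeval c) q (p / q)).symm.trans hroot) with hc | hc
    · exact (hγ c (mem_aroots.2 ⟨hq.ne_zero, hc⟩)).trans_lt (hbδ ▸ hlt)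
    · exact hmin.val_X_sub_C_lt hbδ hdiv (mem_aroots.2 ⟨right_ne_zero_of_mul hne, hc⟩)
  have hmul_lt := lt_val_C_aeval_sub hμ hmul_roots hp (val_le_val_mul_div hle)
  have hmod_lt := lt_val_C_aeval_sub hμ (fun c hc => hmin.val_X_sub_C_lt hbδ hmod hc) hp hle
  have hpb : aeval b p = 0 := by rw [hg, map_mul, minpoly.aeval, zero_mul]
  have hsplit : C (aeval b p) - p.map (algebraMap K L) =
      (C (aeval b (q * (p / q))) - (q * (p / q)).map (algebraMap K L)) +
        (C (aeval b (p % q)) - (p % q).map (algebraMap K L)) := by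
    conv_lhs => rw [← EuclideanDomain.div_add_mod p q]
    rw [map_add, C_add, Polynomial.map_add, add_sub_add_comm]
  refine lt_irrefl (ν p) ?_
  calc ν p < μ (C (aeval b p) - p.map (algebraMap K L)) :=
        hsplit ▸ μ.map_lt_add hmul_lt hmod_lt
    _ = ν p := by rw [hpb, C_0, zero_sub, μ.map_neg, hμ]

end Extension

end KeyPoly

theorem theorem1p1
    {K : Type*} [Field K] {L : Type*} [Field L] [Algebra K L] [IsAlgClosure K L]
    {Γ : Type*} [AddCommGroup Γ] [LinearOrder Γ] [IsOrderedAddMonoid Γ]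
    (ν : AddValuation K[X] (WithTop Γ)) (hν : ∀ f : K[X], ν f = ⊤ → f = 0)
    (μ : AddValuation L[X] (WithTop Γ)) (hμ : ∀ f : K[X], μ (f.map (algebraMap K L)) = ν f)
    (Q : K[X]) (hQ : Q.Monic) (hQirr : Irreducible Q)
    (δ : Γ) (hδ : KeyPoly.delta μ Q = ((δ : WithTop Γ) : WithBot (WithTop Γ)))
    (a : L) (haQ : aeval a Q = 0) (ha : μ (X - C a) = (δ : WithTop Γ)) :
    (KeyPoly.IsKeyPolynomial ν Q ↔ KeyPoly.IsMinimalPair K μ a δ) ∧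
    (KeyPoly.IsKeyPolynomial ν Q →
      (KeyPoly.IsMinimalPairOfDefinition K μ a δ ↔ ∀ p : K[X], ν p = KeyPoly.truncation ν Q p)) ∧
    (KeyPoly.IsMinimalPairOfDefinition K μ a δ → ∀ p : K[X], ν p = KeyPoly.truncation ν Q p) ∧
    ((∀ p : K[X], ν p = KeyPoly.truncation ν Q p) → ∀ b : L, μ (X - C b) ≤ μ (X - C a)) := by
  have : IsAlgClosed L := IsAlgClosure.isAlgClosed K
  have : Algebra.IsAlgebraic K L := IsAlgClosure.isAlgebraic
  obtain rfl : Q = minpoly K a := minpoly.eq_of_irreducible_of_monic hQirr haQ hQ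
  have hkey : KeyPoly.IsKeyPolynomial ν (minpoly K a) ↔ KeyPoly.IsMinimalPair K μ a δ :=
    KeyPoly.isKeyPolynomial_minpoly_iff_isMinimalPair hν hμ ha hδ
  have htrunc (h : KeyPoly.IsMinimalPairOfDefinition K μ a δ) (p : K[X]) :
      ν p = KeyPoly.truncation ν (minpoly K a) p := h.eq_truncation hμ p
  have hmax (h : ∀ p : K[X], ν p = KeyPoly.truncation ν (minpoly K a) p) (b : L) :
      μ (X - C b) ≤ δ :=
    KeyPoly.val_X_sub_C_le_of_eq_truncation hν hμ hQ hQirr.natDegree_pos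
      (fun _ => KeyPoly.val_X_sub_C_le_of_mem_aroots hδ) h b
  exact ⟨hkey, fun hQkey => ⟨htrunc, fun h => ⟨hkey.1 hQkey, ha, hmax h⟩⟩, htrunc,
    fun h b => (hmax h b).trans_eq ha.symm⟩
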